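/- Let $d\in(0,1)$. The binary deletion channel with deletion probability $d$ deletes each bit of an input word $x\in\{0,1\}^n$ independently with probability $d$ and outputs the word $y$ formed by the remaining bits, in their order (its length is between $0$ and $n$); write $W^n(y\mid x)$ for its transition probabilities. A deletion pattern from $x\in\{0,1\}^n$ to $y\in\{0,1\}^m$ is a $D\in\{0,1\}^n$ such that deleting from $x$ the bits $x_i$ with $D_i=1$ leaves $y$, and $\#(x,y)$ is the number of these patterns. All logarithms are to base $2$, and $h(d)=-d\log d-(1-d)\log(1-d)$. Let $C(d)$ be the capacity of the channel, i.e. the supremum of the rates $R$ such that for all $\varepsilon,\delta>0$ and all sufficiently large $n$ there is a code of block length $n$ with $M\ge 1$ messages, $\frac1n\log M>R-\delta$, and average error probability at most $\varepsilon$. Then, with $m=\lceil n(1-d)\rceil$, $$C(d)\;\le\;\liminf_{n\to\infty}\frac1n\log\Bigl(\sum_{y\in\{0,1\}^m}\max_{x\in\{0,1\}^n}\#(x,y)\Bigr)-h(d).$$ The same bound holds for the information-theoretic expression of the capacity, $\liminf_{n\to\infty}\frac1n\sup_{X^n} I(X^n;Y(X^n))$, where the supremum is over all distributions of the input word $X^n\in\{0,1\}^n$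 and $Y(X^n)$ is the corresponding channel output. -/

import Mathlib

namespace BDC

/-- Binary words of length `n`. -/
abbrev Word (n : ℕ) : Type := Fin n → Bool

/-- Output words of the deletion channel with block length `n`: binary words of flexible length
`m ≤ n` (the empty word, received when every bit is deleted, included). -/
abbrev Output (n : ℕ) : Type := Σ m : Fin (n + 1), Word (m : ℕ)

/-- The word that is left of `x` after applying the deletion pattern `D`; the bit `x i` is deleted
when `D i = true` and kept when `D i = false`. -/
def applyPattern {n : ℕ} (D : Fin n → Bool) (x : Word n) : List Bool :=
  ((List.finRange n).filter (fun i => !D i)).map x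

/-- `#(x, y)`: the number of deletion patterns that turn `x` into `y`. -/
def numPatterns {n m : ℕ} (x : Word n) (y : Word m) : ℕ :=
  (Finset.univ.filter (fun D : Fin n → Bool => applyPattern D x = List.ofFn y)).card

/-- The probability of the deletion pattern `D` when each bit is deleted independently with
probability `d`. -/
noncomputable def patternProb (d : ℝ) {n : ℕ} (D : Fin n → Bool) : ℝ :=
  ∏ i, if D i = true then d else 1 - d

/-- Transition probability `W(y | x)` of the binary deletion channel with block length `n`: the
probability that the random deletion pattern turns `x` into `y`. -/
noncomputable def channel (d : ℝ) (n : ℕ) (x : Word n) (y : Output n) : ℝ :=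
  ∑ D ∈ Finset.univ.filter (fun D : Fin n → Bool => applyPattern D x = List.ofFn y.2),
    patternProb d D

/-- Mutual information (in bits) between the input and the output of a finite channel `W`, the
input having distribution `p`. -/
noncomputable def mutualInfo {X Y : Type} [Fintype X] [Fintype Y] (p : X → ℝ) (W : X → Y → ℝ) :
    ℝ :=
  ∑ x, ∑ y, p x * W x y * Real.logb 2 (W x y / ∑ x', p x' * W x' y)

/-- `C_n(d) = (1/n) sup I(X^n; Y(X^n))`, over all distributions of the input word `X^n`. -/
noncomputable def blockCapacity (d : ℝ) (n : ℕ) : EReal :=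
  ⨆ p ∈ stdSimplex ℝ (Word n), ((1 / (n : ℝ) * mutualInfo p (channel d n) : ℝ) : EReal)

/-- The capacity expressed through mutual information: `liminf C_n(d)`. -/
noncomputable def infoCapacity (d : ℝ) : EReal :=
  Filter.liminf (fun n : ℕ => blockCapacity d n) Filter.atTop

/-- Average error probability of a code with `M` messages, encoder `enc` and decoder `dec`. -/
noncomputable def avgError (d : ℝ) {n M : ℕ} (enc : Fin M → Word n) (dec : Output n → Fin M) : ℝ :=
  1 / (M : ℝ) *
    ∑ w, ∑ y ∈ Finset.univ.filter (fun y : Output n => dec y ≠ w), channel d n (enc w) y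

/-- `R` (in bits per channel input) is achievable if for all `ε, δ > 0` and all sufficiently large
`n` there is a code of block length `n`, with rate larger than `R - δ` and average error probability
at most `ε`. -/
def Achievable (d R : ℝ) : Prop :=
  ∀ ε > (0 : ℝ), ∀ δ > (0 : ℝ), ∀ᶠ n : ℕ in Filter.atTop,
    ∃ M : ℕ, 1 ≤ M ∧ R - δ < 1 / (n : ℝ) * Real.logb 2 M ∧
      ∃ (enc : Fin M → Word n) (dec : Output n → Fin M), avgError d enc dec ≤ ε

/-- The operational capacity: the supremum of all achievable rates. -/
noncomputable def operationalCapacity (d : ℝ) : EReal :=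
  ⨆ R ∈ {R : ℝ | Achievable d R}, (R : EReal)

/-- Binary entropy in bits. -/
noncomputable def entropy (d : ℝ) : ℝ :=
  -d * Real.logb 2 d - (1 - d) * Real.logb 2 (1 - d)

/-- `(1/n) log ∑_{y ∈ {0,1}^m} max_{x ∈ {0,1}^n} #(x, y)` with `m = ⌈n (1 - d)⌉`. -/
noncomputable def mlExponent (d : ℝ) (n : ℕ) : ℝ :=
  1 / (n : ℝ) * Real.logb 2
    ((∑ y : Word ⌈(n : ℝ) * (1 - d)⌉₊, Finset.univ.sup (fun x : Word n => numPatterns x y) : ℕ) : ℝ)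

end BDC

/-!
The maximum-likelihood bound on the capacity of the deletion channel.

Write `S n l` for the sum over `y ∈ {0,1}^l` of `max_x #(x, y)` (`patternSum n l`). A pattern leading
to an output of length `l` has probability `d ^ (n - l) * (1 - d) ^ l`, so
`W(y | x) = d ^ (n - l) * (1 - d) ^ l * #(x, y)`. Take as reference output distribution `r` the one
with uniform length on `{0, …, n}` and, given the length, with `y` proportional to `max_x #(x, y)`
(`refOutput`). Then `W(y | x) / r(y) ≤ (n + 1) * d ^ (n - l) * (1 - d) ^ l * S n l`, a bound that
depends on `y` only through its length `l`.

Adjacent values of `S n` are comparable up to a factor `2 n`: one bit can be removed from an output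
at the cost of a factor `n` in the number of patterns (`numPatterns_cons_le_mul`), and conversely
a pattern that deletes something can keep one bit more (`numPatterns_le_sum_insertNth`). Hence
`S n l ≤ (2 n) ^ |l - m| * S n m` with `m = ⌈n (1 - d)⌉`, and
`log (W(y | x) / r(y)) ≤ log (S n m) - n h(d) + O(log n) * (1 + |l - n (1 - d)|)`
(`channel_le_refOutput_mul`). For every input the output length has mean `n (1 - d)` and variance
at most `n`, so that the typical deviation `√n` costs `O(√n log n) = o(n)` only, and no sharper
concentration is needed.

Both bounds follow from this estimate. The mutual information is at most the mean of
`log (W / r)`, by Gibbs' inequality (`mutualInfo_channel_le`). For a code, a correct decoding occurs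
either at an output whose length deviates by more than `4 √n`, with probability at most `1 / 16`,
or where `W ≤ T * r`, with average probability at most `T / M`; so error probability at most `1 / 2`
forces `M ≤ 4 T` (`card_messages_le`).
-/

namespace BDC

open Filter Topology

/-! ### Counting deletion patterns -/

theorem applyPattern_cons {n : ℕ} (b : Bool) (D : Fin n → Bool) (a : Bool) (x : Word n) :
    applyPattern (Fin.cons b D : Fin (n + 1) → Bool) (Fin.cons a x : Word (n + 1)) =
      if b = true then applyPattern D x else a :: applyPattern D x := by
  unfold applyPattern
  rw [List.finRange_succ]
  cases b <;> simp [List.filter_map, Function.comp_def]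

theorem numPatterns_eq_sum {n m : ℕ} (x : Word n) (y : Word m) :
    numPatterns x y =
      ∑ D : Fin n → Bool, if applyPattern D x = List.ofFn y then 1 else 0 := by
  rw [numPatterns, Finset.card_filter]

theorem sum_fin_succ_bool {M : Type*} [AddCommMonoid M] {n : ℕ} (f : (Fin (n + 1) → Bool) → M) :
    ∑ D, f D =
      ∑ D : Fin n → Bool, f (Fin.cons true D) + ∑ D : Fin n → Bool, f (Fin.cons false D) := by
  rw [← (Fin.consEquiv (fun _ : Fin (n + 1) => Bool)).sum_comp, Fintype.sum_prod_type]
  simp [Fin.consEquiv]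

theorem numPatterns_cons {n m : ℕ} (a : Bool) (x : Word n) (y : Word m) :
    numPatterns (Fin.cons a x : Word (n + 1)) y = numPatterns x y +
      ∑ D : Fin n → Bool, if a :: applyPattern D x = List.ofFn y then 1 else 0 := by
  rw [numPatterns_eq_sum, numPatterns_eq_sum, sum_fin_succ_bool]
  simp [applyPattern_cons]

/-- Recursion on the first input bit: a pattern either deletes it, or keeps it and matches it with
the first output bit. -/
theorem numPatterns_cons_cons {n m : ℕ} (a : Bool) (x : Word n) (c : Bool) (y : Word m) :
    numPatterns (Fin.cons a x : Word (n + 1)) (Fin.cons c y : Word (m + 1)) =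
      numPatterns x (Fin.cons c y : Word (m + 1)) + if a = c then numPatterns x y else 0 := by
  rw [numPatterns_cons, numPatterns_eq_sum x y]
  congr 1
  by_cases h : a = c <;> simp [List.ofFn_succ, h]

theorem numPatterns_le_cons {n m : ℕ} (a : Bool) (x : Word n) (y : Word m) :
    numPatterns x y ≤ numPatterns (Fin.cons a x : Word (n + 1)) y := by
  rw [numPatterns_cons]; exact Nat.le_add_right _ _

theorem numPatterns_zero_left (x : Word 0) {m : ℕ} (y : Word (m + 1)) :
    numPatterns x y = 0 := by
  simp [numPatterns, applyPattern, List.ofFn_succ]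

theorem numPatterns_zero_right {n : ℕ} (x : Word n) (y : Word 0) : numPatterns x y = 1 := by
  induction n with
  | zero => simp [numPatterns, applyPattern]
  | succ n ih =>
    rw [← Fin.cons_self_tail x, numPatterns_cons, ih]
    simp

/-- A pattern for `c y` becomes a pattern for `y` by deleting the first kept bit, and it can be
recovered from the position of that bit. -/
theorem numPatterns_cons_le_mul {n m : ℕ} (x : Word n) (c : Bool) (y : Word m) :
    numPatterns x (Fin.cons c y : Word (m + 1)) ≤ n * numPatterns x y := by
  induction n with
  | zero => simp [numPatterns_zero_left]
  | succ n ih =>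
    rw [← Fin.cons_self_tail x, numPatterns_cons_cons]
    have h1 := ih (Fin.tail x)
    have h2 := numPatterns_le_cons (x 0) (Fin.tail x) y
    have h3 : (if x 0 = c then numPatterns (Fin.tail x) y else 0) ≤ numPatterns (Fin.tail x) y := by
      split_ifs <;> omega
    nlinarith

/-- A pattern with a shorter output deletes at least one bit; keeping one of the deleted bits inserts
a bit somewhere in the output. -/
theorem numPatterns_le_sum_insertNth {n m : ℕ} (hmn : m < n) (x : Word n) (y : Word m) :
    numPatterns x y ≤
      ∑ i : Fin (m + 1), ∑ b : Bool, numPatterns x (Fin.insertNth i b y : Word (m + 1)) := by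
  induction n generalizing m with
  | zero => omega
  | succ n ih =>
    rw [← Fin.cons_self_tail x]
    generalize x 0 = a
    generalize Fin.tail x = x
    rw [Fin.sum_univ_succ]
    -- inserting `a` in front recovers the patterns that delete the first bit of the input
    have h0 : numPatterns x y ≤ ∑ b : Bool, numPatterns (Fin.cons a x : Word (n + 1))
        (Fin.insertNth 0 b y : Word (m + 1)) := by
      refine le_trans ?_ (Finset.single_le_sum (fun b _ => Nat.zero_le _) (Finset.mem_univ a))
      simp [numPatterns_cons_cons]
    cases m with
    | zero => simpa [numPatterns_zero_right] using h0
    | succ m =>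
      rw [← Fin.cons_self_tail y] at h0 ⊢
      generalize y 0 = c at *
      generalize Fin.tail y = y at *
      rw [numPatterns_cons_cons]
      refine add_le_add h0 ?_
      split_ifs with hac
      · refine (ih (by omega) x y).trans
          (Finset.sum_le_sum fun i _ => Finset.sum_le_sum fun b _ => ?_)
        have : (Fin.insertNth i.succ b (Fin.cons c y : Word (m + 1)) : Word (m + 2)) =
            Fin.cons c (Fin.insertNth i b y : Word (m + 1)) := by
          ext j
          refine Fin.cases ?_ (fun j => ?_) j
          · rw [Fin.cons_zero]
            have : (0 : Fin (m + 2)) = i.succ.succAbove 0 := by simp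
            rw [this, Fin.insertNth_apply_succAbove, Fin.cons_zero]
          · rw [Fin.cons_succ]
            refine Fin.succAboveCases i ?_ (fun k => ?_) j
            · simp
            · rw [← Fin.succ_succAbove_succ, Fin.insertNth_apply_succAbove,
                Fin.insertNth_apply_succAbove, Fin.cons_succ]
        rw [this, numPatterns_cons_cons, if_pos hac]
        exact Nat.le_add_left _ _
      · exact Nat.zero_le _

theorem exists_numPatterns_pos {n m : ℕ} (hmn : m ≤ n) (y : Word m) :
    ∃ x : Word n, 0 < numPatterns x y := by
  induction n generalizing m with
  | zero =>
    obtain rfl : m = 0 := by omega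
    exact ⟨y, by simp [numPatterns_zero_right]⟩
  | succ n ih =>
    cases m with
    | zero => exact ⟨fun _ => false, by simp [numPatterns_zero_right]⟩
    | succ m =>
      obtain ⟨x, hx⟩ := ih (by omega) (Fin.tail y)
      refine ⟨Fin.cons (y 0) x, ?_⟩
      rw [← Fin.cons_self_tail y, numPatterns_cons_cons]
      simp; omega

/-! ### Sums of maximal pattern counts -/

/-- The largest number of deletion patterns that turn a word of length `n` into `y`. -/
def maxPatterns (n : ℕ) {m : ℕ} (y : Word m) : ℕ :=
  Finset.univ.sup fun x : Word n => numPatterns x y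

/-- The sum, over all words `y` of length `m`, of the largest number of deletion patterns that turn
a word of length `n` into `y`. -/
def patternSum (n m : ℕ) : ℕ := ∑ y : Word m, maxPatterns n y

theorem numPatterns_le_maxPatterns {n m : ℕ} (x : Word n) (y : Word m) :
    numPatterns x y ≤ maxPatterns n y :=
  Finset.le_sup (f := fun x : Word n => numPatterns x y) (Finset.mem_univ x)

theorem maxPatterns_pos {n m : ℕ} (hmn : m ≤ n) (y : Word m) : 0 < maxPatterns n y := by
  obtain ⟨x, hx⟩ := exists_numPatterns_pos hmn y
  exact hx.trans_le (numPatterns_le_maxPatterns x y)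

theorem patternSum_pos {n m : ℕ} (hmn : m ≤ n) : 0 < patternSum n m :=
  Finset.sum_pos (fun y _ => maxPatterns_pos hmn y) Finset.univ_nonempty

theorem patternSum_succ_le (n m : ℕ) : patternSum n (m + 1) ≤ 2 * n * patternSum n m := by
  have key (c : Bool) (y : Word m) :
      maxPatterns n (Fin.cons c y : Word (m + 1)) ≤ n * maxPatterns n y :=
    Finset.sup_le fun x _ => (numPatterns_cons_le_mul x c y).trans
      (Nat.mul_le_mul_left _ (numPatterns_le_maxPatterns x y))
  unfold patternSum
  rw [sum_fin_succ_bool, mul_assoc, two_mul, Finset.mul_sum]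
  exact add_le_add (Finset.sum_le_sum fun y _ => key _ y) (Finset.sum_le_sum fun y _ => key _ y)

/-- With `x` a maximizer for `y`, every pattern from `x` to `y` is charged to some `y'` obtained from
`y` by inserting one bit, and each `y'` arises from at most `m + 1 ≤ n` insertion positions. -/
theorem patternSum_le_succ {n m : ℕ} (hmn : m < n) :
    patternSum n m ≤ n * patternSum n (m + 1) := by
  have key (y : Word m) : maxPatterns n y ≤
      ∑ i : Fin (m + 1), ∑ b : Bool, maxPatterns n (Fin.insertNth i b y : Word (m + 1)) :=
    Finset.sup_le fun x _ => (numPatterns_le_sum_insertNth hmn x y).trans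
      (Finset.sum_le_sum fun i _ => Finset.sum_le_sum fun b _ => numPatterns_le_maxPatterns x _)
  calc patternSum n m
      ≤ ∑ y : Word m, ∑ i : Fin (m + 1), ∑ b : Bool,
          maxPatterns n (Fin.insertNth i b y : Word (m + 1)) := Finset.sum_le_sum fun y _ => key y
    _ = ∑ i : Fin (m + 1), ∑ y : Word m, ∑ b : Bool,
          maxPatterns n (Fin.insertNth i b y : Word (m + 1)) := Finset.sum_comm
    _ = ∑ _i : Fin (m + 1), patternSum n (m + 1) := by
        refine Finset.sum_congr rfl fun i _ => ?_
        unfold patternSum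
        rw [← (Fin.insertNthEquiv (fun _ : Fin (m + 1) => Bool) i).sum_comp,
          Fintype.sum_prod_type, Finset.sum_comm]
        rfl
    _ = (m + 1) * patternSum n (m + 1) := by simp
    _ ≤ n * patternSum n (m + 1) := Nat.mul_le_mul_right _ hmn

theorem patternSum_le_pow_mul {n l m k : ℕ} (hn : 0 < n) (hl : l ≤ n) (hm : m ≤ n)
    (h1 : l ≤ m + k) (h2 : m ≤ l + k) :
    patternSum n l ≤ (2 * n) ^ k * patternSum n m := by
  have up (j : ℕ) : patternSum n (m + j) ≤ (2 * n) ^ j * patternSum n m := by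
    induction j with
    | zero => simp
    | succ j ih =>
      refine (patternSum_succ_le n (m + j)).trans ?_
      rw [pow_succ', mul_assoc (2 * n)]
      exact Nat.mul_le_mul_left _ ih
  have down (j : ℕ) (hj : l + j ≤ n) : patternSum n l ≤ (2 * n) ^ j * patternSum n (l + j) := by
    induction j with
    | zero => simp
    | succ j ih =>
      refine (ih (by omega)).trans ?_
      rw [pow_succ, mul_assoc]
      refine Nat.mul_le_mul_left _ ((patternSum_le_succ (by omega)).trans ?_)
      exact Nat.mul_le_mul_right _ (by omega)
  have mono {j : ℕ} (hj : j ≤ k) :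
      (2 * n) ^ j * patternSum n m ≤ (2 * n) ^ k * patternSum n m :=
    Nat.mul_le_mul_right _ (Nat.pow_le_pow_right (by omega) hj)
  rcases le_total m l with h | h
  · obtain ⟨j, rfl⟩ := Nat.exists_eq_add_of_le h
    exact (up j).trans (mono (by omega))
  · obtain ⟨j, rfl⟩ := Nat.exists_eq_add_of_le h
    exact (down j hm).trans (mono (by omega))

/-! ### The length of the channel output -/

/-- The number of bits that the deletion pattern `D` keeps. -/
def keptCount {n : ℕ} (D : Fin n → Bool) : ℕ := ∑ i, if D i = true then 0 else 1

theorem keptCount_le {n : ℕ} (D : Fin n → Bool) : keptCount D ≤ n := by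
  calc keptCount D ≤ ∑ _i : Fin n, 1 := Finset.sum_le_sum fun i _ => by split_ifs <;> omega
    _ = n := by simp

theorem keptCount_cons {n : ℕ} (b : Bool) (D : Fin n → Bool) :
    keptCount (Fin.cons b D : Fin (n + 1) → Bool) = (if b = true then 0 else 1) + keptCount D := by
  rw [keptCount, Fin.sum_univ_succ]; simp [keptCount]

theorem length_applyPattern {n : ℕ} (D : Fin n → Bool) (x : Word n) :
    (applyPattern D x).length = keptCount D := by
  induction n with
  | zero => simp [applyPattern, keptCount]
  | succ n ih =>
    rw [← Fin.cons_self_tail x, ← Fin.cons_self_tail D, applyPattern_cons, keptCount,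
      Fin.sum_univ_succ]
    have := ih (Fin.tail D) (Fin.tail x)
    rw [keptCount] at this
    cases D 0 <;> simp [this, add_comm]

theorem patternProb_eq {n : ℕ} (d : ℝ) (D : Fin n → Bool) :
    patternProb d D = d ^ (n - keptCount D) * (1 - d) ^ keptCount D := by
  induction n with
  | zero => simp [patternProb, keptCount]
  | succ n ih =>
    have h := ih (Fin.tail D)
    have hle := keptCount_le (Fin.tail D)
    rw [patternProb] at h ⊢
    rw [← Fin.cons_self_tail D, Fin.prod_univ_succ]
    have hk : keptCount (Fin.cons (D 0) (Fin.tail D) : Fin (n + 1) → Bool) =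
        (if D 0 = true then 0 else 1) + keptCount (Fin.tail D) := by
      rw [keptCount, Fin.sum_univ_succ]; simp [keptCount]
    rw [hk]
    simp only [Fin.cons_zero, Fin.cons_succ, h]
    cases D 0
    · simp only [Bool.false_eq_true, if_false]
      rw [show n + 1 - (1 + keptCount (Fin.tail D)) = n - keptCount (Fin.tail D) by omega]
      ring
    · simp only [if_true, zero_add]
      rw [show n + 1 - keptCount (Fin.tail D) = n - keptCount (Fin.tail D) + 1 by omega]
      ring

theorem patternProb_nonneg {n : ℕ} {d : ℝ} (hd0 : 0 < d) (hd1 : d < 1) (D : Fin n → Bool) :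
    0 ≤ patternProb d D :=
  Finset.prod_nonneg fun i _ => by split_ifs <;> linarith

theorem patternProb_cons {n : ℕ} (d : ℝ) (b : Bool) (D : Fin n → Bool) :
    patternProb d (Fin.cons b D : Fin (n + 1) → Bool) =
      (if b = true then d else 1 - d) * patternProb d D := by
  rw [patternProb, Fin.prod_univ_succ]; simp [patternProb]

theorem sum_patternProb (d : ℝ) (n : ℕ) : ∑ D : Fin n → Bool, patternProb d D = 1 := by
  induction n with
  | zero => simp [patternProb]
  | succ n ih =>
    rw [sum_fin_succ_bool]
    simp only [patternProb_cons, ← Finset.mul_sum, ih]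
    simp

/-- The variance of the number of kept bits; the linear terms of the two cases for the first bit
cancel. -/
theorem sum_patternProb_mul_keptCount_sub_sq (d : ℝ) (n : ℕ) :
    ∑ D : Fin n → Bool, patternProb d D * ((keptCount D : ℝ) - n * (1 - d)) ^ 2 =
      n * (d * (1 - d)) := by
  induction n with
  | zero => simp [keptCount]
  | succ n ih =>
    rw [sum_fin_succ_bool, ← Finset.sum_add_distrib]
    calc _ = ∑ D : Fin n → Bool, (patternProb d D * ((keptCount D : ℝ) - n * (1 - d)) ^ 2 +
            d * (1 - d) * patternProb d D) := by
          refine Finset.sum_congr rfl fun D _ => ?_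
          simp only [patternProb_cons, keptCount_cons]
          push_cast
          simp
          ring
      _ = _ := by
          rw [Finset.sum_add_distrib, ih, ← Finset.mul_sum, sum_patternProb]
          push_cast
          ring

/-- The channel output for the input `x` and the deletion pattern `D`. -/
def outputOf {n : ℕ} (x : Word n) (D : Fin n → Bool) : Output n :=
  ⟨⟨(applyPattern D x).length, by
    rw [length_applyPattern]; exact Nat.lt_succ_of_le (keptCount_le D)⟩, (applyPattern D x).get⟩

theorem applyPattern_eq_ofFn_iff {n : ℕ} (x : Word n) (D : Fin n → Bool) (y : Output n) :
    applyPattern D x = List.ofFn y.2 ↔ outputOf x D = y := by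
  constructor
  · intro h
    obtain ⟨⟨m, hm⟩, y⟩ := y
    have hlen : (applyPattern D x).length = m := by rw [h]; simp
    subst hlen
    have : (applyPattern D x).get = y := by
      apply List.ofFn_injective
      exact (List.ofFn_get _).trans h
    rw [outputOf, this]
  · rintro rfl
    exact (List.ofFn_get _).symm

/-- The output length has, for every input, the law of the number of kept bits. -/
theorem sum_channel_mul {n : ℕ} (d : ℝ) (x : Word n) (f : ℕ → ℝ) :
    ∑ y : Output n, channel d n x y * f y.1 =
      ∑ D : Fin n → Bool, patternProb d D * f (keptCount D) := by
  rw [← Finset.sum_fiberwise (s := Finset.univ) (g := outputOf x)]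
  refine Finset.sum_congr rfl fun y _ => ?_
  rw [channel, Finset.sum_mul]
  simp only [applyPattern_eq_ofFn_iff]
  refine Finset.sum_congr rfl fun D hD => ?_
  rw [← (Finset.mem_filter.1 hD).2, ← length_applyPattern D x]
  rfl

theorem channel_eq {n : ℕ} (d : ℝ) (x : Word n) (y : Output n) :
    channel d n x y = d ^ (n - (y.1 : ℕ)) * (1 - d) ^ (y.1 : ℕ) * numPatterns x y.2 := by
  rw [channel, numPatterns, Finset.sum_congr rfl (g := fun _ =>
    d ^ (n - (y.1 : ℕ)) * (1 - d) ^ (y.1 : ℕ)), Finset.sum_const, nsmul_eq_mul, mul_comm]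
  intro D hD
  have hlen : keptCount D = y.1 := by
    rw [← length_applyPattern D x, (Finset.mem_filter.1 hD).2, List.length_ofFn]
  rw [patternProb_eq, hlen]

theorem channel_nonneg {n : ℕ} {d : ℝ} (hd0 : 0 < d) (hd1 : d < 1) (x : Word n) (y : Output n) :
    0 ≤ channel d n x y :=
  Finset.sum_nonneg fun D _ => patternProb_nonneg hd0 hd1 D

theorem sum_channel {n : ℕ} (d : ℝ) (x : Word n) : ∑ y : Output n, channel d n x y = 1 := by
  simpa [sum_patternProb] using sum_channel_mul d x (fun _ => 1)

theorem sum_channel_mul_sq_le {n : ℕ} {d : ℝ} (x : Word n) :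
    ∑ y : Output n, channel d n x y * (((y.1 : ℕ) : ℝ) - n * (1 - d)) ^ 2 ≤ (n : ℝ) := by
  rw [sum_channel_mul d x (fun l => ((l : ℝ) - n * (1 - d)) ^ 2),
    sum_patternProb_mul_keptCount_sub_sq]
  have : (0 : ℝ) ≤ n := n.cast_nonneg
  nlinarith [sq_nonneg (1 - 2 * d)]

theorem sum_channel_mul_abs_le {n : ℕ} {d : ℝ} (hn : 0 < n) (hd0 : 0 < d) (hd1 : d < 1)
    (x : Word n) :
    ∑ y : Output n, channel d n x y * |((y.1 : ℕ) : ℝ) - n * (1 - d)| ≤ √n := by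
  have hs : 0 < √(n : ℝ) := Real.sqrt_pos.2 (by exact_mod_cast hn)
  have hss : √(n : ℝ) * √n = n := Real.mul_self_sqrt n.cast_nonneg
  -- `|z| ≤ (√n + z² / √n) / 2`
  have h1 (y : Output n) : channel d n x y * |((y.1 : ℕ) : ℝ) - n * (1 - d)| ≤
      √n / 2 * channel d n x y +
        1 / (2 * √n) * (channel d n x y * (((y.1 : ℕ) : ℝ) - n * (1 - d)) ^ 2) := by
    set z := ((y.1 : ℕ) : ℝ) - n * (1 - d)
    have : |z| ≤ √n / 2 + 1 / (2 * √n) * z ^ 2 := by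
      rw [div_add' _ _ _ (by norm_num), div_mul_eq_mul_div, le_div_iff₀ (by norm_num)]
      rw [← sq_abs z]
      field_simp
      nlinarith [sq_nonneg (|z| - √n)]
    nlinarith [mul_le_mul_of_nonneg_left this (channel_nonneg hd0 hd1 x y)]
  refine (Finset.sum_le_sum fun y _ => h1 y).trans ?_
  rw [Finset.sum_add_distrib, ← Finset.mul_sum, ← Finset.mul_sum, sum_channel]
  have h2 : 1 / (2 * √n) * ∑ y : Output n, channel d n x y * (((y.1 : ℕ) : ℝ) - n * (1 - d)) ^ 2 ≤
      1 / (2 * √n) * n := mul_le_mul_of_nonneg_left (sum_channel_mul_sq_le x) (by positivity)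
  have h3 : 1 / (2 * √n) * (n : ℝ) = √n / 2 := by
    field_simp; linarith
  linarith

/-- Chebyshev's inequality for the output length. -/
theorem sum_channel_far_le {n : ℕ} {d : ℝ} (hn : 0 < n) (hd0 : 0 < d) (hd1 : d < 1)
    (x : Word n) :
    ∑ y : Output n with 4 * √n < |((y.1 : ℕ) : ℝ) - n * (1 - d)|, channel d n x y ≤ 1 / 16 := by
  have hn' : (0 : ℝ) < n := by exact_mod_cast hn
  have hss : √(n : ℝ) * √n = n := Real.mul_self_sqrt n.cast_nonneg
  calc ∑ y : Output n with 4 * √n < |((y.1 : ℕ) : ℝ) - n * (1 - d)|, channel d n x y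
      ≤ ∑ y : Output n with 4 * √n < |((y.1 : ℕ) : ℝ) - n * (1 - d)|,
          1 / (16 * n) * (channel d n x y * (((y.1 : ℕ) : ℝ) - n * (1 - d)) ^ 2) := by
        refine Finset.sum_le_sum fun y hy => ?_
        have hy := (Finset.mem_filter.1 hy).2
        set z := ((y.1 : ℕ) : ℝ) - n * (1 - d)
        have h16 : 16 * (n : ℝ) ≤ z ^ 2 := by
          rw [← sq_abs z]; nlinarith [Real.sqrt_nonneg (n : ℝ)]
        rw [div_mul_eq_mul_div, le_div_iff₀ (by positivity)]
        nlinarith [channel_nonneg hd0 hd1 x y]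
    _ ≤ ∑ y : Output n, 1 / (16 * n) *
          (channel d n x y * (((y.1 : ℕ) : ℝ) - n * (1 - d)) ^ 2) :=
        Finset.sum_le_sum_of_subset_of_nonneg (Finset.filter_subset _ _) fun y _ _ =>
          mul_nonneg (by positivity) (mul_nonneg (channel_nonneg hd0 hd1 x y) (sq_nonneg _))
    _ ≤ 1 / (16 * n) * n := by
        rw [← Finset.mul_sum]
        exact mul_le_mul_of_nonneg_left (sum_channel_mul_sq_le x) (by positivity)
    _ = 1 / 16 := by field_simp

/-! ### The reference output distribution -/

/-- The reference output distribution: the length is uniform on `{0, …, n}`, and a word `y` of the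
chosen length has probability proportional to the largest number of deletion patterns ending
in `y`. -/
noncomputable def refOutput (n : ℕ) (y : Output n) : ℝ :=
  maxPatterns n y.2 / ((n + 1) * patternSum n y.1)

theorem refOutput_pos {n : ℕ} (y : Output n) : 0 < refOutput n y := by
  have hl : (y.1 : ℕ) ≤ n := Nat.le_of_lt_succ y.1.2
  have h1 : (0 : ℝ) < maxPatterns n y.2 := by exact_mod_cast maxPatterns_pos hl y.2
  have h2 : (0 : ℝ) < patternSum n y.1 := by exact_mod_cast patternSum_pos hl
  unfold refOutput
  positivity

theorem sum_refOutput (n : ℕ) : ∑ y : Output n, refOutput n y = 1 := by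
  rw [Fintype.sum_sigma]
  have h (l : Fin (n + 1)) : ∑ y : Word l, refOutput n ⟨l, y⟩ = 1 / (n + 1) := by
    have h2 : (0 : ℝ) < patternSum n l := by
      exact_mod_cast patternSum_pos (Nat.le_of_lt_succ l.2)
    simp only [refOutput]
    rw [← Finset.sum_div, ← Nat.cast_sum]
    change (patternSum n l : ℝ) / _ = _
    field_simp
  simp only [h]
  simp
  field_simp

/-- The coefficient of `|l - n (1 - d)|` in the exponential bound on the likelihood ratio at an
output of length `l`. -/
noncomputable def lengthSlope (d : ℝ) (n : ℕ) : ℝ :=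
  |Real.logb 2 (1 - d) - Real.logb 2 d| + Real.logb 2 (2 * n)

/-- The bound on the logarithm of the likelihood ratio at an output of length `n (1 - d)`. -/
noncomputable def centralBound (d : ℝ) (n : ℕ) : ℝ :=
  n * (mlExponent d n - entropy d) + Real.logb 2 (n + 1) + Real.logb 2 (2 * n)

theorem logb_two_mul_nonneg {n : ℕ} (hn : 0 < n) : 0 ≤ Real.logb 2 (2 * n) := by
  have : (1 : ℝ) ≤ n := by exact_mod_cast hn
  exact Real.logb_nonneg one_lt_two (by linarith)

theorem lengthSlope_nonneg {n : ℕ} (hn : 0 < n) (d : ℝ) : 0 ≤ lengthSlope d n :=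
  add_nonneg (abs_nonneg _) (logb_two_mul_nonneg hn)

theorem logb_patternSum_le {n : ℕ} {d : ℝ} (hn : 0 < n) (hd0 : 0 < d) (hd1 : d < 1) {l : ℕ}
    (hl : l ≤ n) :
    Real.logb 2 (patternSum n l) ≤
      n * mlExponent d n + (|(l : ℝ) - n * (1 - d)| + 1) * Real.logb 2 (2 * n) := by
  have hn' : (0 : ℝ) < n := by exact_mod_cast hn
  set m := ⌈(n : ℝ) * (1 - d)⌉₊ with hm_def
  have hm : m ≤ n := Nat.ceil_le.2 (by nlinarith)
  have hm1 : (n : ℝ) * (1 - d) ≤ m := Nat.le_ceil _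
  have hm2 : (m : ℝ) < n * (1 - d) + 1 := Nat.ceil_lt_add_one (by nlinarith)
  have hml : n * mlExponent d n = Real.logb 2 (patternSum n m) := by
    rw [mlExponent, ← mul_assoc, mul_one_div_cancel hn'.ne', one_mul]
    rfl
  -- truncated subtraction: one summand vanishes and `k = |l - m|`
  set k := (l - m) + (m - l) with hk_def
  have hk : (k : ℝ) ≤ |(l : ℝ) - n * (1 - d)| + 1 := by
    rcases le_total m l with h | h
    · obtain ⟨j, rfl⟩ := Nat.exists_eq_add_of_le h
      have : k = j := by omega
      rw [this]
      push_cast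
      have := le_abs_self ((m : ℝ) + j - n * (1 - d))
      linarith
    · obtain ⟨j, hj⟩ := Nat.exists_eq_add_of_le h
      have : k = j := by omega
      rw [this]
      have := neg_le_abs ((l : ℝ) - n * (1 - d))
      have hj' : (m : ℝ) = l + j := by exact_mod_cast hj
      linarith
  have hS : (patternSum n l : ℝ) ≤ (2 * n) ^ k * patternSum n m := by
    exact_mod_cast patternSum_le_pow_mul hn hl hm (by omega) (by omega)
  have hSl : (0 : ℝ) < patternSum n l := by exact_mod_cast patternSum_pos hl
  have hSm : (0 : ℝ) < patternSum n m := by exact_mod_cast patternSum_pos hm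
  have h := Real.logb_le_logb_of_le one_lt_two hSl hS
  rw [Real.logb_mul (by positivity) hSm.ne', Real.logb_pow] at h
  have := mul_le_mul_of_nonneg_right hk (logb_two_mul_nonneg hn)
  linarith

/-- Exponential bound on the likelihood ratio against the reference distribution, uniform over the
inputs and depending on the output through its length only. -/
theorem channel_le_refOutput_mul {n : ℕ} {d : ℝ} (hn : 0 < n) (hd0 : 0 < d) (hd1 : d < 1)
    (x : Word n) (y : Output n) :
    channel d n x y ≤ refOutput n y *
      2 ^ (centralBound d n + lengthSlope d n * |((y.1 : ℕ) : ℝ) - n * (1 - d)|) := by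
  have hl : (y.1 : ℕ) ≤ n := Nat.le_of_lt_succ y.1.2
  obtain ⟨l, hl_def⟩ : ∃ l : ℕ, l = y.1 := ⟨_, rfl⟩
  have h1d : 0 < 1 - d := by linarith
  have hS : (0 : ℝ) < patternSum n y.1 := by exact_mod_cast patternSum_pos hl
  have hN : (numPatterns x y.2 : ℝ) ≤ maxPatterns n y.2 := by
    exact_mod_cast numPatterns_le_maxPatterns x y.2
  have hmain : d ^ (n - (y.1 : ℕ)) * (1 - d) ^ (y.1 : ℕ) * ((n + 1) * patternSum n y.1) ≤
      2 ^ (centralBound d n + lengthSlope d n * |((y.1 : ℕ) : ℝ) - n * (1 - d)|) := by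
    have hS2 := logb_patternSum_le hn hd0 hd1 hl
    rw [← hl_def] at hl hS hS2 ⊢
    rw [← Real.logb_le_iff_le_rpow one_lt_two (by positivity),
      Real.logb_mul (by positivity) (by positivity), Real.logb_mul (by positivity) (by positivity),
      Real.logb_mul (by positivity) (by positivity), Real.logb_pow, Real.logb_pow,
      Nat.cast_sub hl, centralBound, lengthSlope, entropy]
    set z := (l : ℝ) - n * (1 - d) with hz
    have hlz : (l : ℝ) = z + n * (1 - d) := by rw [hz]; ring
    have habs : z * (Real.logb 2 (1 - d) - Real.logb 2 d) ≤
        |Real.logb 2 (1 - d) - Real.logb 2 d| * |z| := by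
      rw [mul_comm |_| |z|, ← abs_mul]; exact le_abs_self _
    rw [hlz]
    nlinarith
  rw [channel_eq]
  calc d ^ (n - (y.1 : ℕ)) * (1 - d) ^ (y.1 : ℕ) * (numPatterns x y.2 : ℝ)
      ≤ d ^ (n - (y.1 : ℕ)) * (1 - d) ^ (y.1 : ℕ) * maxPatterns n y.2 :=
        mul_le_mul_of_nonneg_left hN (by positivity)
    _ = refOutput n y *
          (d ^ (n - (y.1 : ℕ)) * (1 - d) ^ (y.1 : ℕ) * ((n + 1) * patternSum n y.1)) := by
        unfold refOutput
        field_simp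
    _ ≤ _ := mul_le_mul_of_nonneg_left hmain (refOutput_pos y).le

/-! ### Mutual information and codes -/

/-- Replacing the true output distribution in the mutual information by any positive
subprobability `r` can only increase it. -/
theorem mutualInfo_le_of_le_mul_rpow {X Y : Type} [Fintype X] [Fintype Y] {p : X → ℝ}
    (hp : ∀ x, 0 ≤ p x) {W : X → Y → ℝ} (hW : ∀ x y, 0 ≤ W x y) (hp1 : ∑ x, p x = 1)
    (hW1 : ∀ x, ∑ y, W x y = 1) {r : Y → ℝ} (hr : ∀ y, 0 < r y) (hr1 : ∑ y, r y ≤ 1) {b : Y → ℝ}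
    (hb : ∀ x y, W x y ≤ r y * 2 ^ b y) :
    mutualInfo p W ≤ ∑ x, p x * ∑ y, W x y * b y := by
  set q : Y → ℝ := fun y => ∑ x, p x * W x y with hq
  have hlog2 : 0 < Real.log 2 := Real.log_pos one_lt_two
  have hterm (x : X) (y : Y) : p x * W x y * Real.logb 2 (W x y / q y) ≤
      p x * W x y * b y + p x * W x y * ((r y / q y - 1) / Real.log 2) := by
    rcases (mul_nonneg (hp x) (hW x y)).eq_or_lt with h0 | hpos
    · simp [← h0]
    have hWpos : 0 < W x y := (hW x y).lt_of_ne fun h => by simp [← h] at hpos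
    have hqpos : 0 < q y := hpos.trans_le
      (Finset.single_le_sum (f := fun x => p x * W x y)
        (fun x _ => mul_nonneg (hp x) (hW x y)) (Finset.mem_univ x))
    rw [← mul_add]
    refine mul_le_mul_of_nonneg_left ?_ hpos.le
    have hsplit : W x y / q y = W x y / r y * (r y / q y) := by
      have := (hr y).ne'
      field_simp
    rw [hsplit, Real.logb_mul (div_pos hWpos (hr y)).ne' (div_pos (hr y) hqpos).ne']
    refine add_le_add ?_ ?_
    · rw [Real.logb_le_iff_le_rpow one_lt_two (div_pos hWpos (hr y)), div_le_iff₀' (hr y)]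
      exact hb x y
    · rw [Real.logb]
      exact div_le_div_of_nonneg_right (Real.log_le_sub_one_of_pos (div_pos (hr y) hqpos)) hlog2.le
  have hq1 : ∑ y, q y = 1 := by
    rw [hq, Finset.sum_comm]
    simp [← Finset.mul_sum, hW1, hp1]
  -- the correction term is `(∑ r - ∑ q) / log 2`, up to the outputs with `q y = 0`
  have hcorr : ∑ x, ∑ y, p x * W x y * ((r y / q y - 1) / Real.log 2) ≤ 0 := by
    rw [Finset.sum_comm]
    simp only [← Finset.sum_mul]
    calc ∑ y, q y * ((r y / q y - 1) / Real.log 2)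
        ≤ ∑ y, (r y - q y) / Real.log 2 := by
          refine Finset.sum_le_sum fun y _ => ?_
          rw [← mul_div_assoc]
          refine div_le_div_of_nonneg_right ?_ hlog2.le
          rcases eq_or_ne (q y) 0 with h | h
          · simp [h, (hr y).le]
          · rw [mul_sub, mul_div_cancel₀ _ h, mul_one]
      _ = (∑ y, r y - 1) / Real.log 2 := by
          rw [← Finset.sum_div, Finset.sum_sub_distrib, hq1]
      _ ≤ 0 := div_nonpos_of_nonpos_of_nonneg (by linarith) hlog2.le
  calc mutualInfo p W
      ≤ ∑ x, ∑ y, (p x * W x y * b y + p x * W x y * ((r y / q y - 1) / Real.log 2)) :=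
        Finset.sum_le_sum fun x _ => Finset.sum_le_sum fun y _ => hterm x y
    _ = ∑ x, ∑ y, p x * W x y * b y +
          ∑ x, ∑ y, p x * W x y * ((r y / q y - 1) / Real.log 2) := by
        simp only [Finset.sum_add_distrib]
    _ ≤ ∑ x, ∑ y, p x * W x y * b y := by linarith
    _ = _ := by simp only [Finset.mul_sum, mul_assoc]

theorem mutualInfo_channel_le {n : ℕ} {d : ℝ} (hn : 0 < n) (hd0 : 0 < d) (hd1 : d < 1)
    {p : Word n → ℝ} (hp : p ∈ stdSimplex ℝ (Word n)) :
    mutualInfo p (channel d n) ≤ centralBound d n + lengthSlope d n * √n := by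
  refine (mutualInfo_le_of_le_mul_rpow hp.1 (channel_nonneg hd0 hd1) hp.2 (sum_channel d)
    refOutput_pos (sum_refOutput n).le (channel_le_refOutput_mul hn hd0 hd1)).trans ?_
  have h (x : Word n) : ∑ y : Output n, channel d n x y *
      (centralBound d n + lengthSlope d n * |((y.1 : ℕ) : ℝ) - n * (1 - d)|) ≤
      centralBound d n + lengthSlope d n * √n := by
    simp only [mul_add, Finset.sum_add_distrib, ← Finset.sum_mul, sum_channel, one_mul]
    have := mul_le_mul_of_nonneg_left (sum_channel_mul_abs_le hn hd0 hd1 x)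
      (lengthSlope_nonneg hn d)
    rw [Finset.mul_sum] at this
    refine add_le_add le_rfl (le_trans (le_of_eq ?_) this)
    exact Finset.sum_congr rfl fun y _ => by ring
  calc _ ≤ ∑ x, p x * (centralBound d n + lengthSlope d n * √n) :=
        Finset.sum_le_sum fun x _ => mul_le_mul_of_nonneg_left (h x) (hp.1 x)
    _ = _ := by rw [← Finset.sum_mul, hp.2, one_mul]

/-- The number of messages of a code with error probability at most `1 / 2`: correct decoding at an
output of typical length is limited by the total mass of the reference distribution. -/
theorem card_messages_le {n M : ℕ} {d : ℝ} (hn : 0 < n) (hd0 : 0 < d) (hd1 : d < 1) (hM : 1 ≤ M)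
    (enc : Fin M → Word n) (dec : Output n → Fin M) (herr : avgError d enc dec ≤ 1 / 2) :
    (M : ℝ) ≤ 4 * 2 ^ (centralBound d n + lengthSlope d n * (4 * √n)) := by
  have hM' : (0 : ℝ) < M := by exact_mod_cast hM
  set T : ℝ := 2 ^ (centralBound d n + lengthSlope d n * (4 * √n)) with hT
  have hcorrect (w : Fin M) : 1 ≤
      ∑ y : Output n with dec y ≠ w, channel d n (enc w) y + 1 / 16 +
        ∑ y : Output n with dec y = w, refOutput n y * T := by
    refine (sum_channel d (enc w)).symm.le.trans ?_
    rw [← Finset.sum_filter_not_add_sum_filter Finset.univ (fun y => dec y = w), add_assoc]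
    refine add_le_add le_rfl ?_
    rw [← Finset.sum_filter_add_sum_filter_not (Finset.univ.filter fun y => dec y = w)
      (fun y : Output n => 4 * √n < |((y.1 : ℕ) : ℝ) - n * (1 - d)|)]
    refine add_le_add (le_trans ?_ (sum_channel_far_le hn hd0 hd1 (enc w))) ?_
    · exact Finset.sum_le_sum_of_subset_of_nonneg
        (Finset.filter_subset_filter _ (Finset.subset_univ _))
        fun y _ _ => channel_nonneg hd0 hd1 _ _
    · refine (Finset.sum_le_sum fun y hy => ?_).trans
        (Finset.sum_le_sum_of_subset_of_nonneg (Finset.filter_subset _ _) fun y _ _ =>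
          mul_nonneg (refOutput_pos y).le (by positivity))
      refine (channel_le_refOutput_mul hn hd0 hd1 (enc w) y).trans
        (mul_le_mul_of_nonneg_left ?_ (refOutput_pos y).le)
      refine Real.rpow_le_rpow_of_exponent_le one_le_two (add_le_add le_rfl ?_)
      exact mul_le_mul_of_nonneg_left (not_lt.1 (Finset.mem_filter.1 hy).2)
        (lengthSlope_nonneg hn d)
  have hsum := Finset.sum_le_sum fun w (_ : w ∈ Finset.univ) => hcorrect w
  rw [Finset.sum_add_distrib, Finset.sum_add_distrib,
    Finset.sum_fiberwise (s := Finset.univ) (g := dec) (f := fun y => refOutput n y * T),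
    ← Finset.sum_mul, sum_refOutput] at hsum
  simp only [Finset.sum_const, Finset.card_univ, Fintype.card_fin, nsmul_eq_mul] at hsum
  rw [avgError, div_mul_eq_mul_div, one_mul, div_le_iff₀ hM'] at herr
  linarith

/-! ### Asymptotics -/

/-- The slack, per channel input, between the rate of the channel and `mlExponent d n - entropy d`
at block length `n`. -/
noncomputable def slack (d : ℝ) (n : ℕ) : ℝ :=
  (Real.logb 2 (n + 1) + Real.logb 2 (2 * n) + lengthSlope d n * (4 * √n) + 2) / n

theorem centralBound_eq_slack {n : ℕ} (hn : 0 < n) (d : ℝ) :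
    1 / (n : ℝ) * (centralBound d n + lengthSlope d n * (4 * √n) + 2) =
      mlExponent d n - entropy d + slack d n := by
  have hn' : (0 : ℝ) < n := by exact_mod_cast hn
  unfold centralBound slack
  field_simp
  ring

theorem tendsto_slack (d : ℝ) : Tendsto (slack d) atTop (𝓝 0) := by
  have hsq : Tendsto (fun n : ℕ => √(n : ℝ)) atTop atTop :=
    Real.tendsto_sqrt_atTop.comp tendsto_natCast_atTop_atTop
  have hinv : Tendsto (fun n : ℕ => (√(n : ℝ))⁻¹) atTop (𝓝 0) := hsq.inv_tendsto_atTop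
  have hlog : Tendsto (fun n : ℕ => Real.log n / √n) atTop (𝓝 0) := by
    have h := (isLittleO_log_rpow_atTop (r := 1 / 2) (by norm_num)).tendsto_div_nhds_zero.comp
      (tendsto_natCast_atTop_atTop (R := ℝ))
    simpa [Function.comp_def, Real.sqrt_eq_rpow] using h
  set a := |Real.logb 2 (1 - d) - Real.logb 2 d|
  have hmaj : Tendsto (fun n : ℕ =>
      (1 + Real.log n / Real.log 2 + 1 + Real.log n / Real.log 2 + 2) / √n * (√(n : ℝ))⁻¹ +
        4 * ((a + (1 + Real.log n / Real.log 2)) / √n)) atTop (𝓝 0) := by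
    have h1 (c e : ℝ) : Tendsto (fun n : ℕ => c * (√(n : ℝ))⁻¹ + e * (Real.log n / √n)) atTop
        (𝓝 0) := by
      simpa using (hinv.const_mul c).add (hlog.const_mul e)
    have h2 := ((h1 4 (2 / Real.log 2)).mul hinv).add ((h1 (a + 1) (1 / Real.log 2)).const_mul 4)
    simp only [mul_zero, add_zero] at h2
    refine h2.congr fun n => ?_
    ring
  refine squeeze_zero' ?_ ?_ hmaj
  · filter_upwards [eventually_gt_atTop 0] with n hn
    have h1 : 0 ≤ Real.logb 2 ((n : ℝ) + 1) :=
      Real.logb_nonneg one_lt_two (by linarith [(Nat.cast_nonneg n : (0 : ℝ) ≤ n)])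
    have h2 := logb_two_mul_nonneg hn
    have h3 := lengthSlope_nonneg hn d
    unfold slack
    positivity
  · filter_upwards [eventually_gt_atTop 0] with n hn
    have hn' : (0 : ℝ) < n := by exact_mod_cast hn
    have hn1 : (1 : ℝ) ≤ n := by exact_mod_cast hn
    have h2 : Real.logb 2 (2 * n) = 1 + Real.log n / Real.log 2 := by
      rw [Real.logb_mul two_ne_zero hn'.ne', Real.logb_self_eq_one one_lt_two]
      rfl
    have h1 : Real.logb 2 ((n : ℝ) + 1) ≤ 1 + Real.log n / Real.log 2 := by
      rw [← h2]
      exact Real.logb_le_logb_of_le one_lt_two (by positivity) (by linarith)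
    have hs : 0 < √(n : ℝ) := Real.sqrt_pos.2 hn'
    have hss : √(n : ℝ) * √n = n := Real.mul_self_sqrt hn'.le
    have hR : (1 + Real.log n / Real.log 2 + 1 + Real.log n / Real.log 2 + 2) / √n * (√(n : ℝ))⁻¹ +
        4 * ((a + (1 + Real.log n / Real.log 2)) / √n) =
        (1 + Real.log n / Real.log 2 + 1 + Real.log n / Real.log 2 + 2 +
          (a + (1 + Real.log n / Real.log 2)) * (4 * √n)) / (√n * √n) := by
      field_simp
    rw [hR, hss, slack, lengthSlope, h2]
    refine div_le_div_of_nonneg_right ?_ hn'.le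
    linarith

theorem blockCapacity_le {n : ℕ} {d : ℝ} (hn : 0 < n) (hd0 : 0 < d) (hd1 : d < 1) :
    blockCapacity d n ≤ ((mlExponent d n - entropy d + slack d n : ℝ) : EReal) := by
  refine iSup₂_le fun p hp => EReal.coe_le_coe_iff.2 ?_
  rw [← centralBound_eq_slack hn]
  refine mul_le_mul_of_nonneg_left ?_ (by positivity)
  have h1 := mutualInfo_channel_le hn hd0 hd1 hp
  have h2 := mul_nonneg (lengthSlope_nonneg hn d) (Real.sqrt_nonneg (n : ℝ))
  linarith

theorem rate_le {n M : ℕ} {d : ℝ} (hn : 0 < n) (hd0 : 0 < d) (hd1 : d < 1) (hM : 1 ≤ M)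
    (enc : Fin M → Word n) (dec : Output n → Fin M) (herr : avgError d enc dec ≤ 1 / 2) :
    1 / (n : ℝ) * Real.logb 2 M ≤ mlExponent d n - entropy d + slack d n := by
  rw [← centralBound_eq_slack hn]
  refine mul_le_mul_of_nonneg_left ?_ (by positivity)
  have hM' : (0 : ℝ) < M := by exact_mod_cast hM
  rw [Real.logb_le_iff_le_rpow one_lt_two hM', Real.rpow_add two_pos _ 2, mul_comm]
  have := card_messages_le hn hd0 hd1 hM enc dec herr
  norm_num at this ⊢
  exact this

/-- The slack vanishes in the limit inferior. Extended reals are used throughout, so no boundedness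
of `mlExponent` is needed. -/
theorem liminf_le_of_eventually_le_slack {d : ℝ} {u : ℕ → EReal}
    (h : ∀ᶠ n in atTop, u n ≤ ((mlExponent d n - entropy d + slack d n : ℝ) : EReal)) :
    liminf u atTop ≤ liminf (fun n => (mlExponent d n : EReal)) atTop - (entropy d : EReal) := by
  have hlim : Tendsto (fun n => ((entropy d - slack d n : ℝ) : EReal)) atTop
      (𝓝 (entropy d : EReal)) := by
    refine (continuous_coe_real_ereal.tendsto _).comp ?_
    simpa using (tendsto_slack d).const_sub (entropy d)
  rw [EReal.le_sub_iff_add_le (by simp) (by simp)]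
  rw [← hlim.liminf_eq]
  refine EReal.le_liminf_add.trans (liminf_le_liminf ?_)
  filter_upwards [h] with n hn
  calc u n + ((entropy d - slack d n : ℝ) : EReal)
      ≤ ((mlExponent d n - entropy d + slack d n : ℝ) : EReal) +
          ((entropy d - slack d n : ℝ) : EReal) := add_le_add hn le_rfl
    _ = mlExponent d n := by
        rw [← EReal.coe_add]; congr 1; ring

end BDC

theorem theorem2 (d : ℝ) (hd0 : 0 < d) (hd1 : d < 1) :
    BDC.operationalCapacity d ≤
        Filter.liminf (fun n : ℕ => (BDC.mlExponent d n : EReal)) Filter.atTop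
          - (BDC.entropy d : EReal) ∧
      BDC.infoCapacity d ≤
        Filter.liminf (fun n : ℕ => (BDC.mlExponent d n : EReal)) Filter.atTop
          - (BDC.entropy d : EReal) := by
  refine ⟨iSup₂_le fun R hR => le_of_forall_lt fun c hc => ?_,
    BDC.liminf_le_of_eventually_le_slack ?_⟩
  · obtain ⟨s, hcs, hsR⟩ := EReal.lt_iff_exists_real_btwn.1 hc
    have hsR : s < R := EReal.coe_lt_coe_iff.1 hsR
    refine hcs.trans_le ?_
    have h := BDC.liminf_le_of_eventually_le_slack (d := d) (u := fun _ => (s : EReal)) ?_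
    · simpa using h
    filter_upwards [hR (1 / 2) (by norm_num) (R - s) (by linarith),
      Filter.eventually_gt_atTop 0] with n hn hn0
    obtain ⟨M, hM, hrate, enc, dec, herr⟩ := hn
    have := BDC.rate_le hn0 hd0 hd1 hM enc dec herr
    exact EReal.coe_le_coe_iff.2 (by linarith)
  · filter_upwards [Filter.eventually_gt_atTop 0] with n hn
    exact BDC.blockCapacity_le hn hd0 hd1
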